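/- Let $\Sigma$ be a finite alphabet, $\#\notin\Sigma$ and $\hat\Sigma=\Sigma\cup\{\#\}$. An $\omega$-picture over $\Sigma$ is a function $p:\omega\times\omega\to\hat\Sigma$ with $p(i,0)=p(0,i)=\#$ for all $i\ge 0$ and $p(i,j)\in\Sigma$ for all $i,j>0$; $\Sigma^{\omega,\omega}$ is the set of all of them. A Büchi tiling system over $\Sigma$ consists of a finite set $Q$ of states, a set $\Delta\subseteq(\hat\Sigma\times Q)^4$ of $2\times 2$ tiles and a set $F\subseteq Q$ of accepting states. An accepting run on $p\in\Sigma^{\omega,\omega}$ is a map $\rho:\omega\times\omega\to Q$ such that, writing $b_{i,j}=(p(i,j),\rho(i,j))$, one has $$\begin{pmatrix} b_{i,j+1} & b_{i+1,j+1}\\ b_{i,j} & b_{i+1,j}\end{pmatrix}\in\Delta\quad\text{for all } i,j\ge 0,$$ and $\rho(v)\in F$ for infinitely many $v\in\omega\times\omega$. The language of the system is the set of $p\in\Sigma^{\omega,\omega}$ that have an accepting run, and the system is unambiguous if every $p\in\Sigma^{\omega,\omega}$ has at most one accepting run. A language $L\subseteq\Sigma^{\omega,\omega}$ is Büchi-recognizable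 if it is the language of some Büchi tiling system over $\Sigma$; a Büchi-recognizable language is inherently ambiguous if it is not the language of any unambiguous Büchi tiling system over $\Sigma$. **Corollary.** There exist a finite alphabet $\Sigma$ and a Büchi-recognizable language $L\subseteq\Sigma^{\omega,\omega}$ that is inherently ambiguous. -/

import Mathlib

/-- The extended alphabet `A ∪ {#}`; the border letter `#` is `none`. -/
abbrev BorderedAlphabet (A : Type*) : Type _ := Option A

/-- `ω`-pictures over `A`: functions `p : ω × ω → A ∪ {#}` with `p(i, 0) = p(0, i) = #` for all `i`,
and `p(i, j) ∈ A` for `i, j > 0`. -/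
def OmegaPicture (A : Type*) : Type _ :=
  {p : ℕ × ℕ → BorderedAlphabet A //
    (∀ i, p (i, 0) = none ∧ p (0, i) = none) ∧
    ∀ i j, 0 < i → 0 < j → ∃ a : A, p (i, j) = some a}

/-- A `2 × 2` tile over `Γ`, with `topLeft, topRight` above `botLeft, botRight`. -/
structure Tile (Γ : Type*) where
  topLeft : Γ
  topRight : Γ
  botLeft : Γ
  botRight : Γ

/-- The tile of `x : ω × ω → Γ` at `(i, j)`; the first coordinate grows to the right and the
second one upwards. -/
def tileAt {Γ : Type*} (x : ℕ × ℕ → Γ) (i j : ℕ) : Tile Γ where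
  topLeft := x (i, j + 1)
  topRight := x (i + 1, j + 1)
  botLeft := x (i, j)
  botRight := x (i + 1, j)

/-- A tiling system with states `Q` and alphabet `A` is a set of tiles over `(A ∪ {#}) × Q`.
Finiteness of `Q` and `A` is required wherever tiling systems are quantified over. -/
structure TilingSystem (Q A : Type*) where
  tiles : Set (Tile (BorderedAlphabet A × Q))

/-- A Büchi tiling system: a tiling system with a set of accepting states. -/
structure BuchiTilingSystem (Q A : Type*) extends TilingSystem Q A where
  accepting : Set Q

/-- `ρ` is a run of the tiling system on the `ω`-picture `p`. -/
def TilingSystem.IsRun {Q A : Type*} (T : TilingSystem Q A) (p : OmegaPicture A)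
    (ρ : ℕ × ℕ → Q) : Prop :=
  ∀ i j : ℕ, tileAt (fun v => (p.1 v, ρ v)) i j ∈ T.tiles

/-- `ρ` is an accepting run on `p`: a run that visits accepting states at infinitely many
positions. -/
def BuchiTilingSystem.IsAcceptingRun {Q A : Type*} (T : BuchiTilingSystem Q A)
    (p : OmegaPicture A) (ρ : ℕ × ℕ → Q) : Prop :=
  T.IsRun p ρ ∧ {v : ℕ × ℕ | ρ v ∈ T.accepting}.Infinite

/-- The language of `ω`-pictures Büchi-recognized by `T`. -/
def BuchiTilingSystem.language {Q A : Type*} (T : BuchiTilingSystem Q A) :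
    Set (OmegaPicture A) :=
  {p | ∃ ρ, T.IsAcceptingRun p ρ}

/-- `T` is unambiguous if every `ω`-picture has at most one accepting run. -/
def BuchiTilingSystem.IsUnambiguous {Q A : Type*} (T : BuchiTilingSystem Q A) : Prop :=
  ∀ (p : OmegaPicture A) (ρ ρ' : ℕ × ℕ → Q),
    T.IsAcceptingRun p ρ → T.IsAcceptingRun p ρ' → ρ = ρ'

/-- `L` is accepted by some Büchi tiling system with finitely many states. -/
def IsBuchiRecognizable {A : Type*} (L : Set (OmegaPicture A)) : Prop :=
  ∃ (Q : Type) (_ : Finite Q) (T : BuchiTilingSystem Q A), T.language = L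

/-- `L` is accepted by some unambiguous Büchi tiling system with finitely many states. -/
def IsUnambiguousLanguage {A : Type*} (L : Set (OmegaPicture A)) : Prop :=
  ∃ (Q : Type) (_ : Finite Q) (T : BuchiTilingSystem Q A), T.IsUnambiguous ∧ T.language = L

/-- A Büchi-recognizable language is inherently ambiguous if it is not unambiguous. -/
def IsInherentlyAmbiguous {A : Type*} (L : Set (OmegaPicture A)) : Prop :=
  IsBuchiRecognizable L ∧ ¬ IsUnambiguousLanguage L

/-! The pictures over `Bool` that are adjacency matrices of graphs with an infinite clique form a
Büchi-recognizable language: a run guesses the clique by marking its columns and rows, and a marked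
diagonal makes the two guesses agree. The language of an unambiguous system is Borel, being an
injective projection of the Borel set of pairs of a picture and an accepting run. The clique
language is not: analytic sets of sequences are the sets of `x` for which some `y` has infinitely
many pairs of initial segments `(x|n, y|n)` in a fixed relation, so the relations coded by sequences
give a diagonal set whose complement is not analytic. Coding `y|n` as a vertex and comparability as
adjacency reduces this set to the clique language. -/

open Filter MeasureTheory PiNat Set Topology

theorem OmegaPicture.eq_none_iff {A : Type*} (p : OmegaPicture A) (i j : ℕ) :
    p.1 (i, j) = none ↔ i = 0 ∨ j = 0 := by
  constructor
  · contrapose!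
    rintro ⟨hi, hj⟩
    obtain ⟨a, ha⟩ := p.2.2 i j (Nat.pos_of_ne_zero hi) (Nat.pos_of_ne_zero hj)
    simp [ha]
  · rintro (rfl | rfl)
    · exact (p.2.1 j).2
    · exact (p.2.1 i).1

/-! ### Pictures with an infinite clique -/

/-- `S` is a clique of the graph whose adjacency matrix is `p`. The diagonal entries are included,
so that vertices without a loop belong to no clique. -/
def OmegaPicture.IsClique (p : OmegaPicture Bool) (S : Set ℕ) : Prop :=
  ∀ i ∈ S, ∀ j ∈ S, p.1 (i, j) = some true

/-- The pictures that have an infinite clique. This is the inherently ambiguous language. -/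
def cliqueLanguage : Set (OmegaPicture Bool) :=
  {p | ∃ S : Set ℕ, S.Infinite ∧ p.IsClique S}

/-- The states of `cliqueSystem`: whether the column and the row of the position belong to the
guessed clique, and whether the position lies on the diagonal. -/
@[ext]
structure CliqueState where
  column : Prop
  row : Prop
  diagonal : Prop

instance : Finite CliqueState :=
  Finite.of_injective (fun q : CliqueState => (q.column, q.row, q.diagonal)) fun _ _ h => by
    simpa only [Prod.mk.injEq, ← CliqueState.ext_iff] using h

/-- The tiles of `cliqueSystem`. On the border, the diagonal position `(0, 0)` is recognized by
the letter `#` both above and to the right of it. -/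
structure IsCliqueTile (t : Tile (BorderedAlphabet Bool × CliqueState)) : Prop where
  column_iff : t.topLeft.2.column ↔ t.botLeft.2.column
  row_iff : t.botRight.2.row ↔ t.botLeft.2.row
  diagonal_iff : t.topRight.2.diagonal ↔ t.botLeft.2.diagonal
  border_diagonal_iff : t.botLeft.1 = none →
    (t.botLeft.2.diagonal ↔ t.topLeft.1 = none ∧ t.botRight.1 = none)
  column_iff_row : t.botLeft.2.diagonal → (t.botLeft.2.column ↔ t.botLeft.2.row)
  edge : t.botLeft.2.column → t.botLeft.2.row → t.botLeft.1 = some true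

/-- A Büchi tiling system that guesses a clique and accepts if it has infinitely many diagonal
positions. -/
def cliqueSystem : BuchiTilingSystem CliqueState Bool where
  tiles := {t | IsCliqueTile t}
  accepting := {q | q.column ∧ q.diagonal}

/-- The run of `cliqueSystem` that guesses the clique `S`. -/
def cliqueRun (S : Set ℕ) (v : ℕ × ℕ) : CliqueState where
  column := v.1 ∈ S
  row := v.2 ∈ S
  diagonal := v.1 = v.2

section CliqueSystem

variable {p : OmegaPicture Bool} {ρ : ℕ × ℕ → CliqueState}

theorem OmegaPicture.IsClique.isRun_cliqueRun {S : Set ℕ} (hS : p.IsClique S) :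
    cliqueSystem.IsRun p (cliqueRun S) := fun i j =>
  { column_iff := Iff.rfl
    row_iff := Iff.rfl
    diagonal_iff := Nat.succ_inj
    border_diagonal_iff := by
      simp only [tileAt, cliqueRun, p.eq_none_iff]
      omega
    column_iff_row := fun h : i = j => show i ∈ S ↔ j ∈ S by rw [h]
    edge := fun hi hj => hS i hi j hj }

theorem column_iff_of_isRun (h : cliqueSystem.IsRun p ρ) (i j : ℕ) :
    (ρ (i, j)).column ↔ (ρ (i, 0)).column := by
  induction j with
  | zero => rfl
  | succ j ih => exact (h i j).column_iff.trans ih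

theorem row_iff_of_isRun (h : cliqueSystem.IsRun p ρ) (i j : ℕ) :
    (ρ (i, j)).row ↔ (ρ (0, j)).row := by
  induction i with
  | zero => rfl
  | succ i ih => exact (h i j).row_iff.trans ih

theorem diagonal_iff_of_isRun (h : cliqueSystem.IsRun p ρ) (i j : ℕ) :
    (ρ (i, j)).diagonal ↔ i = j := by
  have border (i j : ℕ) (hij : i = 0 ∨ j = 0) : (ρ (i, j)).diagonal ↔ i = j := by
    refine ((h i j).border_diagonal_iff ((p.eq_none_iff i j).2 hij)).trans ?_
    simp only [tileAt, p.eq_none_iff]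
    omega
  induction i generalizing j with
  | zero => exact border 0 j (.inl rfl)
  | succ i ih =>
    cases j with
    | zero => exact border (i + 1) 0 (.inr rfl)
    | succ j => exact (h i j).diagonal_iff.trans ((ih j).trans Nat.succ_inj.symm)

theorem exists_eq_cliqueRun_of_isRun (h : cliqueSystem.IsRun p ρ) :
    ∃ S, p.IsClique S ∧ ρ = cliqueRun S := by
  have hrow (i j : ℕ) : (ρ (i, j)).row ↔ (ρ (j, 0)).column :=
    calc (ρ (i, j)).row
      _ ↔ (ρ (j, j)).row := (row_iff_of_isRun h i j).trans (row_iff_of_isRun h j j).symm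
      _ ↔ (ρ (j, j)).column :=
        ((h j j).column_iff_row ((diagonal_iff_of_isRun h j j).2 rfl)).symm
      _ ↔ (ρ (j, 0)).column := column_iff_of_isRun h j j
  refine ⟨{i | (ρ (i, 0)).column}, fun i hi j hj => ?_, funext fun ⟨i, j⟩ => ?_⟩
  · exact (h i j).edge ((column_iff_of_isRun h i j).2 hi) ((hrow i j).2 hj)
  · exact CliqueState.ext (propext (column_iff_of_isRun h i j)) (propext (hrow i j))
      (propext (diagonal_iff_of_isRun h i j))

end CliqueSystem

theorem infinite_accepting_cliqueRun_iff {S : Set ℕ} :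
    {v | cliqueRun S v ∈ cliqueSystem.accepting}.Infinite ↔ S.Infinite := by
  have hdiag : {v | cliqueRun S v ∈ cliqueSystem.accepting} = (fun i => (i, i)) '' S := by
    ext ⟨i, j⟩
    simp only [cliqueRun, cliqueSystem, mem_ofPred_eq, mem_image, Prod.mk.injEq]
    grind
  rw [hdiag, infinite_image_iff fun i _ j _ h => (Prod.mk.inj h).1]

theorem language_cliqueSystem : cliqueSystem.language = cliqueLanguage := by
  ext p
  constructor
  · rintro ⟨ρ, hrun, hacc⟩
    obtain ⟨S, hclique, rfl⟩ := exists_eq_cliqueRun_of_isRun hrun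
    exact ⟨S, infinite_accepting_cliqueRun_iff.1 hacc, hclique⟩
  · rintro ⟨S, hS, hclique⟩
    exact ⟨cliqueRun S, hclique.isRun_cliqueRun, infinite_accepting_cliqueRun_iff.2 hS⟩

theorem isBuchiRecognizable_cliqueLanguage : IsBuchiRecognizable cliqueLanguage :=
  ⟨CliqueState, inferInstance, cliqueSystem, language_cliqueSystem⟩

/-! ### Unambiguous languages are Borel -/

instance {A : Type*} : MeasurableSpace (BorderedAlphabet A) := ⊤

instance {A : Type*} : DiscreteMeasurableSpace (BorderedAlphabet A) := ⟨fun _ => trivial⟩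

/-- The Borel `σ`-algebra of the product topology with discrete cells, when `A` is countable. -/
instance {A : Type*} : MeasurableSpace (OmegaPicture A) := Subtype.instMeasurableSpace

theorem OmegaPicture.measurable_apply {A : Type*} (v : ℕ × ℕ) :
    Measurable fun p : OmegaPicture A => p.1 v :=
  (measurable_pi_apply v).comp measurable_subtype_coe

instance {A : Type*} [Countable A] : StandardBorelSpace (OmegaPicture A) := by
  refine MeasurableSet.standardBorel (α := ℕ × ℕ → BorderedAlphabet A) ?_
  have hcell (v : ℕ × ℕ) (P : BorderedAlphabet A → Prop) :
      Measurable fun p : ℕ × ℕ → BorderedAlphabet A => P (p v) :=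
    Measurable.of_discrete.comp (measurable_pi_apply v)
  refine measurableSet_setOfPred.2
    (.and (.forall fun i => ?_) (.forall fun i => .forall fun j => ?_))
  · exact (hcell (i, 0) (· = none)).and (hcell (0, i) (· = none))
  · exact hcell (i, j) fun c => 0 < i → 0 < j → ∃ a, c = some a

theorem measurableSet_tileAt_mem {Γ : Type*} [Countable Γ] [MeasurableSpace Γ]
    [DiscreteMeasurableSpace Γ] (i j : ℕ) (s : Set (Tile Γ)) :
    MeasurableSet {x : ℕ × ℕ → Γ | tileAt x i j ∈ s} := by
  have hcells : Measurable fun x : ℕ × ℕ → Γ =>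
      (x (i, j + 1), x (i + 1, j + 1), x (i, j), x (i + 1, j)) := by fun_prop
  exact hcells (t := {c | (⟨c.1, c.2.1, c.2.2.1, c.2.2.2⟩ : Tile Γ) ∈ s}) .of_discrete

theorem measurableSet_infinite_preimage {ι Γ : Type*} [Countable ι] [MeasurableSpace Γ]
    {s : Set Γ} (hs : MeasurableSet s) :
    MeasurableSet {x : ι → Γ | (x ⁻¹' s).Infinite} := by
  have hinf (x : ι → Γ) : (x ⁻¹' s).Infinite ↔ ∀ u : Finset ι, ∃ i, i ∉ u ∧ x i ∈ s := by
    refine ⟨fun h u => ?_, fun h hfin => ?_⟩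
    · obtain ⟨i, hi, hiu⟩ := h.exists_notMem_finset u
      exact ⟨i, hiu, hi⟩
    · obtain ⟨i, hiu, hi⟩ := h hfin.toFinset
      exact hiu (hfin.mem_toFinset.2 hi)
  simp only [hinf]
  exact measurableSet_setOfPred.2 (.forall fun u => .exists fun i =>
    measurable_const.and ((measurable_mem.2 hs).comp (measurable_pi_apply i)))

namespace BuchiTilingSystem

variable {Q A : Type*} [Countable Q] [Countable A]

theorem measurableSet_isAcceptingRun [MeasurableSpace Q] [DiscreteMeasurableSpace Q]
    (T : BuchiTilingSystem Q A) :
    MeasurableSet {x : OmegaPicture A × (ℕ × ℕ → Q) | T.IsAcceptingRun x.1 x.2} := by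
  have hcells : Measurable fun (x : OmegaPicture A × (ℕ × ℕ → Q)) (v : ℕ × ℕ) =>
      (x.1.1 v, x.2 v) :=
    measurable_pi_lambda _ fun v => ((OmegaPicture.measurable_apply v).comp measurable_fst).prodMk
      ((measurable_pi_apply v).comp measurable_snd)
  have hrun : MeasurableSet {x : OmegaPicture A × (ℕ × ℕ → Q) | T.IsRun x.1 x.2} :=
    measurableSet_setOfPred.2 (.forall fun i => .forall fun j =>
      measurableSet_setOfPred.1 (hcells (measurableSet_tileAt_mem i j T.tiles)))
  exact hrun.inter (measurable_snd
    (measurableSet_infinite_preimage (MeasurableSet.of_discrete (s := T.accepting))))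

/-- For an unambiguous system the projection from accepting runs to pictures is injective, so the
Lusin–Souslin theorem applies. -/
theorem IsUnambiguous.measurableSet_language {T : BuchiTilingSystem Q A} (hT : T.IsUnambiguous) :
    MeasurableSet T.language := by
  let : MeasurableSpace Q := ⊤
  have : DiscreteMeasurableSpace Q := ⟨fun _ => trivial⟩
  have hlang : T.language =
      Prod.fst '' {x : OmegaPicture A × (ℕ × ℕ → Q) | T.IsAcceptingRun x.1 x.2} := by
    ext p
    simp [language]
  rw [hlang]
  refine T.measurableSet_isAcceptingRun.image_of_measurable_injOn measurable_fst ?_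
  rintro ⟨p, ρ⟩ hρ ⟨_, ρ'⟩ hρ' rfl
  exact Prod.ext rfl (hT p ρ ρ' hρ hρ')

end BuchiTilingSystem

theorem IsUnambiguousLanguage.measurableSet {A : Type*} [Countable A] {L : Set (OmegaPicture A)}
    (hL : IsUnambiguousLanguage L) : MeasurableSet L := by
  obtain ⟨Q, _, T, hT, rfl⟩ := hL
  exact hT.measurableSet_language

/-! ### A set that is analytic but not Borel -/

/-- The projection to `x` of the pairs of sequences `(x, y)` that have infinitely many pairs of
initial segments in `R`. With `β = ℕ`, it is the normal form of an analytic set. -/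
def branchProjection {α β : Type*} (R : Set (List α × List β)) : Set (ℕ → α) :=
  {x | ∃ y : ℕ → β, ∃ᶠ n in atTop, (res x n, res y n) ∈ R}

theorem tendsto_nhds_of_res_eq {ι α : Type*} [TopologicalSpace α] {l : Filter ι} {φ : ι → ℕ}
    (hφ : Tendsto φ l atTop) {z : ι → ℕ → α} {x : ℕ → α}
    (h : ∀ i, res (z i) (φ i) = res x (φ i)) : Tendsto z l (𝓝 x) := by
  refine tendsto_pi_nhds.2 fun k => tendsto_const_nhds.congr' ?_
  filter_upwards [hφ.eventually_gt_atTop k] with i hi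
  exact (res_eq_res.1 (h i) hi).symm

theorem range_eq_branchProjection {α β : Type*} [TopologicalSpace α] [T2Space α]
    [TopologicalSpace β] {f : (ℕ → β) → ℕ → α} (hf : Continuous f) :
    range f = branchProjection {w | ∃ z n, (res (f z) n, res z n) = w} := by
  ext x
  constructor
  · rintro ⟨y, rfl⟩
    exact ⟨y, .of_forall fun n => ⟨y, n, rfl⟩⟩
  · rintro ⟨y, hy⟩
    obtain ⟨φ, hφ, hw⟩ := extraction_of_frequently_atTop hy
    have happrox (n : ℕ) : ∃ z, res (f z) (φ n) = res x (φ n) ∧ res z (φ n) = res y (φ n) := by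
      obtain ⟨z, m, hz⟩ := hw n
      obtain ⟨hx, hy⟩ := Prod.mk.inj hz
      obtain rfl : m = φ n := by simpa only [res_length] using congrArg List.length hy
      exact ⟨z, hx, hy⟩
    choose z hzx hzy using happrox
    have hz : Tendsto z atTop (𝓝 y) := tendsto_nhds_of_res_eq hφ.tendsto_atTop hzy
    have hfz : Tendsto (f ∘ z) atTop (𝓝 x) := tendsto_nhds_of_res_eq hφ.tendsto_atTop hzx
    exact ⟨y, tendsto_nhds_unique ((hf.tendsto y).comp hz) hfz⟩

theorem exists_eq_branchProjection_of_analyticSet {α : Type*} [TopologicalSpace α] [T2Space α]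
    {s : Set (ℕ → α)} (hs : AnalyticSet s) :
    ∃ R : Set (List α × List ℕ), s = branchProjection R := by
  rw [AnalyticSet] at hs
  obtain rfl | ⟨f, hf, rfl⟩ := hs
  · exact ⟨∅, by simp [branchProjection]⟩
  · exact ⟨_, range_eq_branchProjection hf⟩

/-- The subset of `ι` whose characteristic function, along the encoding of `ι`, is `x`. -/
def codedSet (ι : Type*) [Encodable ι] (x : ℕ → Bool) : Set ι :=
  {a | x (Encodable.encode a) = true}

theorem codedSet_surjective (ι : Type*) [Encodable ι] : Function.Surjective (codedSet ι) := by
  classical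
  refine fun R => ⟨fun k => decide (k ∈ Encodable.encode '' R), ?_⟩
  ext a
  simp only [codedSet, mem_ofPred_eq, decide_eq_true_eq, Encodable.encode_injective.mem_set_image]

/-- The codes of relations whose branch projection contains the code itself. -/
def diagonalSet : Set (ℕ → Bool) :=
  {x | x ∈ branchProjection (codedSet (List Bool × List ℕ) x)}

theorem not_measurableSet_diagonalSet : ¬ MeasurableSet diagonalSet := by
  intro h
  have := TopologicalSpace.IsCompletelyMetrizableSpace.pi_countable (X := fun _ : ℕ => Bool)
  have : PolishSpace (ℕ → Bool) := inferInstance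
  obtain ⟨R, hR⟩ := exists_eq_branchProjection_of_analyticSet h.compl.analyticSet
  obtain ⟨x, rfl⟩ := codedSet_surjective _ R
  have : x ∈ diagonalSetᶜ ↔ x ∈ diagonalSet := by rw [hR]; rfl
  exact not_iff_self this

/-! ### Cliques of comparability graphs -/

theorem injOn_length_of_isChain_suffix {α : Type*} {V : Set (List α)} (hV : IsChain (· <:+ ·) V) :
    InjOn List.length V := by
  intro u hu v hv h
  obtain huv | hvu := hV.total hu hv
  · exact huv.eq_of_length h
  · exact (hvu.eq_of_length h.symm).symm

theorem isChain_suffixes {α : Type*} {V : Set (List α)} (hV : IsChain (· <:+ ·) V) :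
    IsChain (· <:+ ·) {u | ∃ v ∈ V, u <:+ v} := by
  rintro u ⟨v, hv, huv⟩ u' ⟨v', hv', huv'⟩ -
  obtain h | h := hV.total hv hv'
  · exact List.suffix_or_suffix_of_suffix (huv.trans h) huv'
  · exact List.suffix_or_suffix_of_suffix huv (huv'.trans h)

theorem exists_subset_range_res {α : Type*} {V : Set (List α)} (hV : V.Infinite)
    (hchain : IsChain (· <:+ ·) V) : ∃ y : ℕ → α, V ⊆ range (res y) := by
  -- The suffixes of members of `V` form a chain with exactly one list `g n` of each length `n`.
  set C := {u | ∃ v ∈ V, u <:+ v}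
  have hlength (n : ℕ) : ∃ u ∈ C, u.length = n := by
    obtain ⟨_, ⟨v, hv, rfl⟩, hn⟩ :=
      (hV.image (injOn_length_of_isChain_suffix hchain)).exists_gt n
    exact ⟨v.drop (v.length - n), ⟨v, hv, v.drop_suffix _⟩, by grind⟩
  choose g hgC hg using hlength
  have heq {u : List α} (hu : u ∈ C) : u = g u.length :=
    injOn_length_of_isChain_suffix (isChain_suffixes hchain) hu (hgC _) (hg _).symm
  have hcons (n : ℕ) : ∃ a, g (n + 1) = a :: g n := by
    obtain ⟨a, u, hau⟩ := List.exists_cons_of_length_eq_add_one (hg (n + 1))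
    have hu : u.length = n := by simpa [hau] using hg (n + 1)
    obtain ⟨v, hv, hsuffix⟩ := hgC (n + 1)
    have huC : u ∈ C := ⟨v, hv, (List.suffix_cons a u).trans (hau ▸ hsuffix)⟩
    exact ⟨a, by rw [hau, heq huC, hu]⟩
  choose y hy using hcons
  have hgy (n : ℕ) : g n = res y n := by
    induction n with
    | zero => exact List.length_eq_zero_iff.1 (hg 0)
    | succ n ih => rw [hy, ih, res_succ]
  exact ⟨y, fun v hv => ⟨v.length, by rw [← hgy, ← heq ⟨v, hv, List.suffix_rfl⟩]⟩⟩

theorem res_suffix_res {α : Type*} (y : ℕ → α) {m n : ℕ} (h : m ≤ n) : res y m <:+ res y n := by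
  induction n, h using Nat.le_induction with
  | base => exact List.suffix_rfl
  | succ n _ ih => exact ih.trans (List.suffix_cons _ _)

theorem exists_infinite_isChain_suffix_iff {α : Type*} {W : Set (List α)} :
    (∃ V ⊆ W, V.Infinite ∧ IsChain (· <:+ ·) V) ↔ ∃ y : ℕ → α, ∃ᶠ n in atTop, res y n ∈ W := by
  simp only [Nat.frequently_atTop_iff_infinite]
  constructor
  · rintro ⟨V, hVW, hV, hchain⟩
    obtain ⟨y, hy⟩ := exists_subset_range_res hV hchain
    refine ⟨y, .of_image (res y) (hV.mono fun v hv => ?_)⟩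
    obtain ⟨n, rfl⟩ := hy hv
    exact ⟨n, hVW hv, rfl⟩
  · rintro ⟨y, hy⟩
    have hinj : Function.Injective (res y) := fun m n h => by
      simpa only [res_length] using congrArg List.length h
    refine ⟨res y '' {n | res y n ∈ W}, image_subset_iff.2 fun _ => id, hy.image hinj.injOn, ?_⟩
    rintro _ ⟨m, -, rfl⟩ _ ⟨n, -, rfl⟩ -
    exact (le_total m n).imp (res_suffix_res y) (res_suffix_res y)

open Classical in
/-- The picture with the adjacency matrix of `r`, whose vertices are enumerated from `1` on because
row and column `0` are the border. -/
noncomputable def adjacencyPicture {ι : Type*} [Denumerable ι] (r : ι → ι → Prop) :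
    OmegaPicture Bool :=
  ⟨fun
    | (i + 1, j + 1) => some (decide (r (Denumerable.ofNat ι i) (Denumerable.ofNat ι j)))
    | (0, _) => none
    | (_, 0) => none,
  fun i => ⟨by cases i <;> rfl, rfl⟩, by
    rintro (_ | i) (_ | j) hi hj
    · contradiction
    · contradiction
    · contradiction
    · exact ⟨_, rfl⟩⟩

section AdjacencyPicture

variable {ι : Type*} [Denumerable ι]

theorem adjacencyPicture_encode_eq_true_iff {r : ι → ι → Prop} (v w : ι) :
    (adjacencyPicture r).1 (Encodable.encode v + 1, Encodable.encode w + 1) = some true ↔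
      r v w := by
  simp [adjacencyPicture]

theorem adjacencyPicture_mem_cliqueLanguage_iff {r : ι → ι → Prop} :
    adjacencyPicture r ∈ cliqueLanguage ↔
      ∃ V : Set ι, V.Infinite ∧ ∀ v ∈ V, ∀ w ∈ V, r v w := by
  set e : ι → ℕ := fun v => Encodable.encode v + 1
  have he : Function.Injective e := (add_left_injective 1).comp Encodable.encode_injective
  constructor
  · rintro ⟨S, hS, hclique⟩
    have hrange : S ⊆ range e := by
      rintro (_ | i) hi
      · have hborder := ((adjacencyPicture r).eq_none_iff 0 0).2 (.inl rfl)
        simp [hclique 0 hi 0 hi] at hborder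
      · exact ⟨Denumerable.ofNat ι i, by simp [e]⟩
    exact ⟨e ⁻¹' S, hS.preimage hrange, fun v hv w hw =>
      (adjacencyPicture_encode_eq_true_iff v w).1 (hclique _ hv _ hw)⟩
  · rintro ⟨V, hV, hr⟩
    refine ⟨e '' V, hV.image he.injOn, ?_⟩
    rintro _ ⟨v, hv, rfl⟩ _ ⟨w, hw, rfl⟩
    exact (adjacencyPicture_encode_eq_true_iff v w).2 (hr v hv w hw)

theorem measurable_adjacencyPicture {Ω : Type*} [MeasurableSpace Ω] {r : Ω → ι → ι → Prop}
    (hr : ∀ v w, Measurable fun x => r x v w) : Measurable fun x => adjacencyPicture (r x) := by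
  classical
  refine Measurable.subtype_mk (measurable_pi_lambda _ ?_)
  rintro ⟨_ | i, _ | j⟩
  · exact measurable_const
  · exact measurable_const
  · exact measurable_const
  · exact (Measurable.of_discrete (f := fun P : Prop => some (decide P))).comp (hr _ _)

end AdjacencyPicture

/-- The picture of the graph on `W` whose edges join the lists that are comparable for the suffix
order, so that a clique is a chain. Suffixes play the part of initial segments since `PiNat.res`
lists a sequence backwards. -/
noncomputable def comparabilityPicture {α : Type*} [Denumerable α] (W : Set (List α)) :
    OmegaPicture Bool :=
  adjacencyPicture fun v w => v ∈ W ∧ w ∈ W ∧ (v <:+ w ∨ w <:+ v)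

theorem comparabilityPicture_mem_cliqueLanguage_iff {α : Type*} [Denumerable α]
    {W : Set (List α)} :
    comparabilityPicture W ∈ cliqueLanguage ↔ ∃ y : ℕ → α, ∃ᶠ n in atTop, res y n ∈ W := by
  rw [comparabilityPicture, adjacencyPicture_mem_cliqueLanguage_iff,
    ← exists_infinite_isChain_suffix_iff]
  constructor
  · rintro ⟨V, hV, hr⟩
    exact ⟨V, fun v hv => (hr v hv v hv).1, hV, fun v hv w hw _ => (hr v hv w hw).2.2⟩
  · rintro ⟨V, hVW, hV, hchain⟩
    exact ⟨V, hV, fun v hv w hw => ⟨hVW hv, hVW hw, hchain.total hv hw⟩⟩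

theorem measurable_comparabilityPicture {Ω α : Type*} [MeasurableSpace Ω] [Denumerable α]
    {W : Ω → Set (List α)} (hW : ∀ v, Measurable fun x => v ∈ W x) :
    Measurable fun x => comparabilityPicture (W x) :=
  measurable_adjacencyPicture fun v w => (hW v).and ((hW w).and measurable_const)

/-! ### Reduction of the diagonal set to the clique language -/

/-- The lists that `R` pairs with the initial segment of `x` of the same length. Membership of `x`
in `branchProjection R` means that infinitely many of them lie on a common branch. -/
def branchFiber {α β : Type*} (R : Set (List α × List β)) (x : ℕ → α) : Set (List β) :=
  {v | (res x v.length, v) ∈ R}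

/-- The reduction of `diagonalSet` to `cliqueLanguage`. -/
noncomputable def diagonalPicture (x : ℕ → Bool) : OmegaPicture Bool :=
  comparabilityPicture (branchFiber (codedSet (List Bool × List ℕ) x) x)

theorem diagonalPicture_mem_cliqueLanguage_iff {x : ℕ → Bool} :
    diagonalPicture x ∈ cliqueLanguage ↔ x ∈ diagonalSet := by
  rw [diagonalPicture, comparabilityPicture_mem_cliqueLanguage_iff]
  simp only [diagonalSet, branchProjection, branchFiber, mem_ofPred_eq, res_length]

theorem measurable_mem_branchFiber_codedSet {β : Type*} [Encodable β] (v : List β) :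
    Measurable fun x => v ∈ branchFiber (codedSet (List Bool × List β) x) x := by
  let : MeasurableSpace (List Bool) := ⊤
  have : DiscreteMeasurableSpace (List Bool) := ⟨fun _ => trivial⟩
  have hres (n : ℕ) : Measurable fun x : ℕ → Bool => res x n := by
    induction n with
    | zero => exact measurable_const
    | succ n ih =>
      exact (Measurable.of_discrete (f := fun c : Bool × List Bool => c.1 :: c.2)).comp
        ((measurable_pi_apply n).prodMk ih)
  have heval : Measurable fun c : (ℕ → Bool) × List Bool => c.1 (Encodable.encode (c.2, v)) :=
    measurable_from_prod_countable_left fun u => measurable_pi_apply (Encodable.encode (u, v))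
  exact (heval.comp (measurable_id.prodMk (hres v.length))).eq_const true

theorem measurable_diagonalPicture : Measurable diagonalPicture :=
  measurable_comparabilityPicture measurable_mem_branchFiber_codedSet

theorem not_measurableSet_cliqueLanguage : ¬ MeasurableSet cliqueLanguage := by
  intro h
  have hpreimage : diagonalPicture ⁻¹' cliqueLanguage = diagonalSet :=
    ext fun _ => diagonalPicture_mem_cliqueLanguage_iff
  exact not_measurableSet_diagonalSet (hpreimage ▸ measurable_diagonalPicture h)

theorem mainTheorem6 :
    ∃ (A : Type) (_ : Finite A) (L : Set (OmegaPicture A)), IsInherentlyAmbiguous L :=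
  ⟨Bool, inferInstance, cliqueLanguage, isBuchiRecognizable_cliqueLanguage,
    fun h => not_measurableSet_cliqueLanguage h.measurableSet⟩
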